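/- Work in an $\aleph_1$-saturated nonstandard model, that is, an elementary (transfer-satisfying) extension of the standard universe, a finite type hierarchy over $\mathbb N$ and $\mathbb R$, in which every countable family of internal sets with the finite intersection property has a common element. Let $k\in{}^*\mathbb N$ be infinite, let $K=\{x\in{}^*\mathbb N: 0\le x<k\}$, let $\mathfrak K$ be the algebra of internal subsets of $K$, and let $\nu(A)=\mathrm{Card}(A)/k\in{}^*\mathbb R$ for $A\in\mathfrak K$, with $\mathrm{Card}$ the internal cardinality. Let $P$ be the Loeb measure of $\nu$, i.e. the measure on $\sigma(\mathfrak K)$ that extends the standard part ${}^\circ\nu$, and denote by $P$ also its completion, defined on the completed $\sigma$-algebra $\mathfrak B$. Let $\phi:K\to K$ be the rotation $\phi(x)=x+1$ for $x<k-1$, $\phi(k-1)=0$. Let $\sigma$ be the left shift on $[0,1]^{\mathbb N}$ and let $\rho$ be a Borel probability measure on $[0,1]^{\mathbb N}$ with $\sigma_*\rho=\rho$. Suppose that $\alpha\in[0,1]^{\mathbb N}$ is typical for $\rho$: $$\lim_{n\to\infty}\frac1n\sum_{i=0}^{n-1}g(\sigma^i\alpha)=\int_{[0,1]^{\mathbb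 N}} g\,d\rho\qquad\text{for every continuous } g:[0,1]^{\mathbb N}\to\mathbb R .$$ Then $([0,1]^{\mathbb N},\rho,\sigma)$ is a factor of $(K,\mathfrak B,P,\phi)$, with factor map $\Gamma(x)={}^\circ(\sigma^x\alpha)$. That is, for every $x\in K$ the point ${}^*H(x)\in{}^*([0,1]^{\mathbb N})$, where $H(n)=\sigma^n\alpha$, has a standard part $\Gamma(x)\in[0,1]^{\mathbb N}$ for the product topology; the map $\Gamma:K\to[0,1]^{\mathbb N}$ is measurable from $\mathfrak B$ to the Borel $\sigma$-algebra; $\Gamma_*P=\rho$; and $\Gamma(\phi(x))=\sigma(\Gamma(x))$ for $P$-almost every $x\in K$. -/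

import Mathlib

open MeasureTheory Filter Topology
open scoped ENNReal unitInterval

namespace Nonstandard

universe u

/-! ### Nonstandard models -/

/-- The types of standard objects: the finite type hierarchy over `ℕ` and `ℝ`, closed under
subtypes, power sets, products and function spaces (a typed form of the superstructure over the
reals). -/
inductive IsStandard : Type → Prop
  | nat : IsStandard ℕ
  | real : IsStandard ℝ
  | sub {A : Type} (s : Set A) : IsStandard A → IsStandard s
  | set {A : Type} : IsStandard A → IsStandard (Set A)
  | prod {A B : Type} : IsStandard A → IsStandard B → IsStandard (A × B)
  | fn {A B : Type} : IsStandard A → IsStandard B → IsStandard (A → B)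

attribute [class] IsStandard

instance instNat : IsStandard ℕ := .nat
instance instReal : IsStandard ℝ := .real
instance instSub {A : Type} [h : IsStandard A] (s : Set A) : IsStandard s := .sub s h
instance instSet {A : Type} [h : IsStandard A] : IsStandard (Set A) := .set h
instance instProd {A B : Type} [h : IsStandard A] [h' : IsStandard B] : IsStandard (A × B) :=
  .prod h h'
instance instFn {A B : Type} [h : IsStandard A] [h' : IsStandard B] : IsStandard (A → B) :=
  .fn h h'

/-- The standard universe: all objects of the finite type hierarchy. -/
structure StdObj : Type 1 where
  type : Type
  isStandard : IsStandard type
  val : type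

/-- An element of a standard type, as an object of the standard universe. -/
def std {A : Type} [h : IsStandard A] (a : A) : StdObj := ⟨A, h, a⟩

/-- The full relational language of the standard universe: a symbol for every finitary relation. -/
def fullLanguage : FirstOrder.Language.{0, 1} where
  Functions := fun _ => Empty
  Relations := fun n => Set (Fin n → StdObj)

instance instStructureStdObj : fullLanguage.Structure StdObj where
  funMap := fun f => Empty.elim f
  RelMap := fun R v => v ∈ (show Set (Fin _ → StdObj) from R)

/-- A nonstandard model: an elementary extension of the standard universe in the full language
(so the transfer principle holds for all first-order formulas). -/
structure Model where
  carrier : Type u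
  str : fullLanguage.Structure carrier
  emb : FirstOrder.Language.ElementaryEmbedding fullLanguage StdObj carrier

attribute [instance] Model.str

namespace Model

variable (M : Model.{u})

/-- The `*`-transform of a finitary relation on standard objects. -/
def Holds {n : ℕ} (R : Set (Fin n → StdObj)) (v : Fin n → M.carrier) : Prop :=
  FirstOrder.Language.Structure.RelMap (L := fullLanguage) (n := n) R v

/-- `M.Ext A` is `*A`, the nonstandard extension of the standard type `A`. -/
def Ext (A : Type) [IsStandard A] : Type u :=
  {m : M.carrier // M.Holds {v : Fin 1 → StdObj | ∃ a : A, v = ![std a]} ![m]}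

section Transforms

variable {A B C : Type} [IsStandard A] [IsStandard B] [IsStandard C]

/-- The `*`-transform of a unary relation (a standard set `{a | R a}`). -/
def Rel₁ (R : A → Prop) (x : M.Ext A) : Prop :=
  M.Holds {v : Fin 1 → StdObj | ∃ a, v = ![std a] ∧ R a} ![x.1]

/-- The `*`-transform of a binary relation. -/
def Rel₂ (R : A → B → Prop) (x : M.Ext A) (y : M.Ext B) : Prop :=
  M.Holds {v : Fin 2 → StdObj | ∃ a b, v = ![std a, std b] ∧ R a b} ![x.1, y.1]

/-- The `*`-transform of a ternary relation. -/
def Rel₃ (R : A → B → C → Prop) (x : M.Ext A) (y : M.Ext B) (z : M.Ext C) : Prop :=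
  M.Holds {v : Fin 3 → StdObj | ∃ a b c, v = ![std a, std b, std c] ∧ R a b c} ![x.1, y.1, z.1]

end Transforms

/-! ### Instances of transfer -/

theorem transfer {n : ℕ} (φ : fullLanguage.BoundedFormula Empty n)
    (h : ∀ w : Fin n → StdObj, φ.Realize default w) (v : Fin n → M.carrier) :
    φ.Realize default v := by
  have h1 : StdObj ⊨ (φ.alls : fullLanguage.Sentence) := by
    rw [FirstOrder.Language.Sentence.Realize, FirstOrder.Language.BoundedFormula.realize_alls]
    exact h
  have h2 := (M.emb.map_sentence _).1 h1
  rw [FirstOrder.Language.Sentence.Realize, FirstOrder.Language.BoundedFormula.realize_alls] at h2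
  exact h2 v

/-- The atomic formula `R (x_{t 0}, …, x_{t (m-1)})`. -/
def atom {m n : ℕ} (R : Set (Fin m → StdObj)) (t : Fin m → Fin n) :
    fullLanguage.BoundedFormula Empty n :=
  FirstOrder.Language.Relations.boundedFormula (L := fullLanguage) (n := m) R
    (fun i => FirstOrder.Language.Term.var (Sum.inr (t i)))

theorem realize_atom {m n : ℕ} (R : Set (Fin m → StdObj)) (t : Fin m → Fin n)
    (v : Fin n → M.carrier) : (atom R t).Realize default v ↔ M.Holds R (v ∘ t) := Iff.rfl

theorem realize_atom_std {m n : ℕ} (R : Set (Fin m → StdObj)) (t : Fin m → Fin n)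
    (w : Fin n → StdObj) : (atom R t).Realize default w ↔ w ∘ t ∈ R := Iff.rfl

variable {M}

theorem holds_mono {n : ℕ} {R S : Set (Fin n → StdObj)} (h : R ⊆ S) {v : Fin n → M.carrier}
    (hv : M.Holds R v) : M.Holds S v :=
  M.transfer ((atom R id).imp (atom S id)) (fun _ hw => h hw) v hv

theorem holds_inter {n : ℕ} {R S : Set (Fin n → StdObj)} {v : Fin n → M.carrier}
    (hR : M.Holds R v) (hS : M.Holds S v) : M.Holds (R ∩ S) v :=
  M.transfer ((atom R id).imp ((atom S id).imp (atom (R ∩ S) id)))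
    (fun _ h1 h2 => ⟨h1, h2⟩) v hR hS

theorem holds_compl {n : ℕ} {R : Set (Fin n → StdObj)} {v : Fin n → M.carrier}
    (hR : ¬ M.Holds R v) : M.Holds Rᶜ v :=
  M.transfer (((atom R id).imp ⊥).imp (atom Rᶜ id)) (fun _ h => h) v hR

theorem holds_comp {m n : ℕ} {R : Set (Fin m → StdObj)} (t : Fin m → Fin n)
    {v : Fin n → M.carrier} (h : M.Holds R (v ∘ t)) : M.Holds {w | w ∘ t ∈ R} v :=
  M.transfer ((atom R t).imp (atom {w | w ∘ t ∈ R} id)) (fun _ h => h) v h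

theorem holds_of_comp {m n : ℕ} {R : Set (Fin m → StdObj)} (t : Fin m → Fin n)
    {v : Fin n → M.carrier} (h : M.Holds {w | w ∘ t ∈ R} v) : M.Holds R (v ∘ t) :=
  M.transfer ((atom {w | w ∘ t ∈ R} id).imp (atom R t)) (fun _ h => h) v h

theorem nonempty_of_holds {n : ℕ} {R : Set (Fin n → StdObj)} {v : Fin n → M.carrier}
    (h : M.Holds R v) : R.Nonempty := by
  by_contra hne
  exact M.transfer ((atom R id).imp ⊥) (fun w hw => hne ⟨w, hw⟩) v h

theorem holds_exists {n : ℕ} {R : Set (Fin (n + 1) → StdObj)} {v : Fin n → M.carrier}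
    (h : M.Holds {w | ∃ y, (Fin.snoc w y : Fin (n + 1) → StdObj) ∈ R} v) :
    ∃ y, M.Holds R (Fin.snoc v y : Fin (n + 1) → M.carrier) := by
  have := M.transfer ((atom {w | ∃ y, (Fin.snoc w y : Fin (n + 1) → StdObj) ∈ R} id).imp
    (atom R id).ex) (fun w hw => by
      rw [FirstOrder.Language.BoundedFormula.realize_ex]
      exact hw) v h
  rwa [FirstOrder.Language.BoundedFormula.realize_ex] at this

theorem holds_std {n : ℕ} {R : Set (Fin n → StdObj)} {w : Fin n → StdObj} (h : w ∈ R) :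
    M.Holds R (M.emb ∘ w) := (M.emb.map_rel (n := n) R w).2 h

theorem std_injective {A : Type} [IsStandard A] {a b : A} (h : std a = std b) : a = b := by
  simpa [std] using h

/-! ### Standard elements and `*`-transforms of functions -/

section Functions

variable {A B C : Type} [IsStandard A] [IsStandard B] [IsStandard C]

variable (M) in
/-- The element `*a` of `*A` given by a standard `a : A`. -/
def const (a : A) : M.Ext A :=
  ⟨M.emb (std a), by
    have h : M.Holds {v : Fin 1 → StdObj | ∃ a : A, v = ![std a]} (M.emb ∘ ![std a]) :=
      holds_std ⟨a, rfl⟩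
    convert! h using 1
    ext i
    fin_cases i
    rfl⟩

theorem exists_map (f : A → B) (x : M.Ext A) :
    ∃ y : M.Ext B, M.Rel₂ (fun a b => f a = b) x y := by
  have h : M.Holds {w : Fin 1 → StdObj | ∃ y, (Fin.snoc w y : Fin 2 → StdObj) ∈
      {v : Fin 2 → StdObj | ∃ a b, v = ![std a, std b] ∧ f a = b}} ![x.1] := by
    refine holds_mono ?_ x.2
    rintro w ⟨a, rfl⟩
    refine ⟨std (f a), a, f a, ?_, rfl⟩
    ext i; fin_cases i <;> rfl
  obtain ⟨y, hy⟩ := holds_exists h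
  have e : (Fin.snoc ![x.1] y : Fin 2 → M.carrier) = ![x.1, y] := by
    ext i; fin_cases i <;> rfl
  rw [e] at hy
  have hy' : M.Holds {v : Fin 1 → StdObj | ∃ b : B, v = ![std b]} (![x.1, y] ∘ ![1]) := by
    refine holds_of_comp ![1] (holds_mono ?_ hy)
    rintro w ⟨a, b, rfl, -⟩
    refine ⟨b, ?_⟩
    ext i; fin_cases i; rfl
  refine ⟨⟨y, ?_⟩, hy⟩
  convert! hy' using 1
  ext i; fin_cases i; rfl

theorem exists_map₂ (f : A → B → C) (x : M.Ext A) (y : M.Ext B) :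
    ∃ z : M.Ext C, M.Rel₃ (fun a b c => f a b = c) x y z := by
  have hx : M.Holds {w : Fin 2 → StdObj | w ∘ ![0] ∈
      {v : Fin 1 → StdObj | ∃ a : A, v = ![std a]}} ![x.1, y.1] := by
    apply holds_comp
    convert! x.2 using 1
    ext i; fin_cases i; rfl
  have hy : M.Holds {w : Fin 2 → StdObj | w ∘ ![1] ∈
      {v : Fin 1 → StdObj | ∃ a : B, v = ![std a]}} ![x.1, y.1] := by
    apply holds_comp
    convert! y.2 using 1
    ext i; fin_cases i; rfl
  have h : M.Holds {w : Fin 2 → StdObj | ∃ z, (Fin.snoc w z : Fin 3 → StdObj) ∈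
      {v : Fin 3 → StdObj | ∃ a b c, v = ![std a, std b, std c] ∧ f a b = c}} ![x.1, y.1] := by
    refine holds_mono ?_ (holds_inter hx hy)
    rintro w ⟨⟨a, ha⟩, b, hb⟩
    refine ⟨std (f a b), a, b, f a b, ?_, rfl⟩
    have ha' := congrFun ha 0
    have hb' := congrFun hb 0
    ext i; fin_cases i
    · exact ha'
    · exact hb'
    · rfl
  obtain ⟨z, hz⟩ := holds_exists h
  have e : (Fin.snoc ![x.1, y.1] z : Fin 3 → M.carrier) = ![x.1, y.1, z] := by
    ext i; fin_cases i <;> rfl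
  rw [e] at hz
  have hz' : M.Holds {v : Fin 1 → StdObj | ∃ c : C, v = ![std c]} (![x.1, y.1, z] ∘ ![2]) := by
    refine holds_of_comp ![2] (holds_mono ?_ hz)
    rintro w ⟨a, b, c, rfl, -⟩
    refine ⟨c, ?_⟩
    ext i; fin_cases i; rfl
  refine ⟨⟨z, ?_⟩, hz⟩
  convert! hz' using 1
  ext i; fin_cases i; rfl

variable (M) in
/-- The `*`-transform `*f : *A → *B` of a function `f : A → B`: the function whose graph is the
`*`-transform of the graph of `f`. -/
noncomputable def map (f : A → B) (x : M.Ext A) : M.Ext B := (exists_map f x).choose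

theorem map_spec (f : A → B) (x : M.Ext A) : M.Rel₂ (fun a b => f a = b) x (M.map f x) :=
  (exists_map f x).choose_spec

variable (M) in
/-- The `*`-transform `*f : *A → *B → *C` of a function of two variables. -/
noncomputable def map₂ (f : A → B → C) (x : M.Ext A) (y : M.Ext B) : M.Ext C :=
  (exists_map₂ f x y).choose

theorem map₂_spec (f : A → B → C) (x : M.Ext A) (y : M.Ext B) :
    M.Rel₃ (fun a b c => f a b = c) x y (M.map₂ f x y) :=
  (exists_map₂ f x y).choose_spec

end Functions

/-! ### Internal sets, saturation, standard parts -/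

variable (M) in
/-- An element `S` of `*𝒫(A)` is regarded as the internal subset `{x | x *∈ S}` of `*A`. -/
def internal {A : Type} [IsStandard A] (S : M.Ext (Set A)) : Set (M.Ext A) :=
  {x | M.Rel₂ (fun (a : A) (s : Set A) => a ∈ s) x S}

variable (M) in
/-- `ℵ₁`-saturation: every countable family of internal sets with the finite intersection property
has a common element. -/
def Saturated : Prop :=
  ∀ (A : Type) [IsStandard A] (S : ℕ → M.Ext (Set A)),
    (∀ n, (⋂ i ≤ n, M.internal (S i)).Nonempty) → (⋂ i, M.internal (S i)).Nonempty

variable (M) in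
/-- `p` is the standard part of `x ∈ *A`: `x` lies in the monad of `p`, that is, in `*U` for every
open neighbourhood `U` of `p`. -/
def IsStandardPart {A : Type} [IsStandard A] [TopologicalSpace A] (x : M.Ext A) (p : A) : Prop :=
  ∀ U : Set A, IsOpen U → p ∈ U → M.Rel₁ (· ∈ U) x

variable (M) in
/-- `k ∈ *ℕ` is infinite. -/
def Infinite (k : M.Ext ℕ) : Prop := ∀ n : ℕ, M.Rel₂ (· < ·) (M.const n) k

/-! ### The hyperfinite rotation -/

variable (M) in
/-- `K = {x ∈ *ℕ | 0 ≤ x < k}`. -/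
def Seg (k : M.Ext ℕ) : Type u := {x : M.Ext ℕ // M.Rel₂ (· < ·) x k}

variable {k : M.Ext ℕ}

/-- The internal subset of `K` cut out by `S ∈ *𝒫(ℕ)`. Every internal subset of `K` is of this
form. -/
def internalSubset (k : M.Ext ℕ) (S : M.Ext (Set ℕ)) : Set (M.Seg k) := {x | x.1 ∈ M.internal S}

/-- The function `(S, n) ↦ |S ∩ [0, n)| / n`. -/
noncomputable def proportion (S : Set ℕ) (n : ℕ) : ℝ := ((S ∩ Set.Iio n).ncard : ℝ) / n

/-- The counting measure `ν(S ∩ K) = Card(S ∩ K) / k ∈ *ℝ`, with `Card` the internal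
cardinality. -/
noncomputable def counting (k : M.Ext ℕ) (S : M.Ext (Set ℕ)) : M.Ext ℝ := M.map₂ proportion S k

open Classical in
/-- The rotation `φ : K → K`, `φ x = x + 1` for `x < k - 1` and `φ (k - 1) = 0`. -/
noncomputable def rotation (hk : M.Infinite k) (x : M.Seg k) : M.Seg k :=
  if h : M.Rel₂ (· < ·) (M.map (· + 1) x.1) k then ⟨M.map (· + 1) x.1, h⟩ else ⟨M.const 0, hk 0⟩

/-- The `σ`-algebra `σ(𝔎)` generated by the algebra `𝔎` of internal subsets of `K`. -/
instance instMeasurableSpaceSeg : MeasurableSpace (M.Seg k) :=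
  MeasurableSpace.generateFrom (Set.range (internalSubset k))

/-- The set function which takes the value `°ν(S)` on an internal set `S ⊆ K`, and `∞` on sets which
are not internal. -/
noncomputable def content (k : M.Ext ℕ) (E : Set (M.Seg k)) : ℝ≥0∞ :=
  ⨅ (S : M.Ext (Set ℕ)) (_ : internalSubset k S = E) (p : ℝ)
    (_ : M.IsStandardPart (counting k S) p), ENNReal.ofReal p

/-- The outer measure on `K` given by countable covers by internal sets. -/
noncomputable def outer (k : M.Ext ℕ) : OuterMeasure (M.Seg k) := OuterMeasure.boundedBy (content k)

/-! The internal sets are Carathéodory measurable. -/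

theorem not_rel₁_biUnion {A : Type} [IsStandard A] {x : M.Ext A} {U : A → Set A} (t : Finset A)
    (h : ∀ p ∈ t, ¬ M.Rel₁ (· ∈ U p) x) : ¬ M.Rel₁ (· ∈ ⋃ p ∈ t, U p) x := by
  classical
  intro hx
  have key : ∀ s : Finset A, s ⊆ t →
      M.Holds {v : Fin 1 → StdObj | ∃ a, v = ![std a] ∧ a ∈ ⋃ p ∈ s, U p}ᶜ ![x.1] := by
    intro s
    induction s using Finset.induction_on with
    | empty =>
      intro _
      apply holds_compl
      intro h0
      obtain ⟨w, a, -, ha⟩ := nonempty_of_holds h0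
      simp at ha
    | insert p s hp ih =>
      intro hs
      have h1 := ih (fun q hq => hs (Finset.mem_insert_of_mem hq))
      have h2 := holds_compl (h p (hs (Finset.mem_insert_self p s)))
      refine holds_mono ?_ (holds_inter h1 h2)
      rintro w ⟨w1, w2⟩ ⟨a, rfl, ha⟩
      rw [Finset.set_biUnion_insert] at ha
      rcases ha with ha | ha
      · exact w2 ⟨a, rfl, ha⟩
      · exact w1 ⟨a, rfl, ha⟩
  obtain ⟨w, w1, w2⟩ := nonempty_of_holds (holds_inter hx (key t subset_rfl))
  exact w2 w1

theorem exists_isStandardPart {A : Type} [IsStandard A] [TopologicalSpace A] {K : Set A}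
    (hK : IsCompact K) {x : M.Ext A} (hx : M.Rel₁ (· ∈ K) x) :
    ∃ p ∈ K, M.IsStandardPart x p := by
  by_contra! hne
  have h1 : ∀ p, ∃ U : Set A, p ∈ K → (IsOpen U ∧ p ∈ U ∧ ¬ M.Rel₁ (· ∈ U) x) := by
    intro p
    by_cases hp : p ∈ K
    · have := hne p hp
      simp only [IsStandardPart, not_forall] at this
      obtain ⟨U, h, h', h''⟩ := this
      exact ⟨U, fun _ => ⟨h, h', h''⟩⟩
    · exact ⟨∅, fun h => absurd h hp⟩
  choose U hU using h1
  obtain ⟨t, ht, hcov⟩ := hK.elim_nhds_subcover U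
    (fun p hp => (hU p hp).1.mem_nhds (hU p hp).2.1)
  refine not_rel₁_biUnion t (fun p hp => (hU p (ht p hp)).2.2) ?_
  refine holds_mono ?_ hx
  rintro w ⟨a, rfl, ha⟩
  exact ⟨a, rfl, hcov ha⟩

theorem proportion_mem (S : Set ℕ) (n : ℕ) : proportion S n ∈ Set.Icc (0 : ℝ) 1 := by
  refine ⟨by unfold proportion; positivity, ?_⟩
  refine div_le_one_of_le₀ ?_ (by positivity)
  have : (S ∩ Set.Iio n).ncard ≤ (Set.Iio n).ncard :=
    Set.ncard_le_ncard Set.inter_subset_right (Set.finite_Iio n)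
  simpa [Set.ncard_eq_toFinset_card'] using this

theorem proportion_add (S T : Set ℕ) (n : ℕ) :
    proportion (S ∩ T) n + proportion (S \ T) n = proportion S n := by
  unfold proportion
  rw [← add_div, ← Nat.cast_add]
  congr 2
  have h := Set.ncard_inter_add_ncard_sdiff_eq_ncard (S ∩ Set.Iio n) T
    ((Set.finite_Iio n).subset Set.inter_subset_right)
  rw [← h]
  congr 2 <;> ext x <;> simp only [Set.mem_inter_iff, Set.mem_sdiff] <;> tauto

theorem exists_standardPart_counting (S : M.Ext (Set ℕ)) :
    ∃ p : ℝ, 0 ≤ p ∧ M.IsStandardPart (counting k S) p := by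
  have hx : M.Rel₁ (· ∈ Set.Icc (0 : ℝ) 1) (counting k S) := by
    have h := map₂_spec proportion S k
    have h' : M.Holds {v : Fin 1 → StdObj | ∃ a, v = ![std a] ∧ a ∈ Set.Icc (0 : ℝ) 1}
        (![S.1, k.1, (counting k S).1] ∘ ![2]) := by
      refine holds_of_comp ![2] (holds_mono ?_ h)
      rintro w ⟨a, b, c, rfl, rfl⟩
      refine ⟨_, ?_, proportion_mem a b⟩
      ext i; fin_cases i; rfl
    have e : ![S.1, k.1, (counting k S).1] ∘ ![2] = ![(counting k S).1] := by
      ext i; fin_cases i; rfl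
    rwa [e] at h'
  obtain ⟨p, hp, h⟩ := exists_isStandardPart isCompact_Icc hx
  exact ⟨p, hp.1, h⟩

theorem pull {m n : ℕ} {R : Set (Fin m → StdObj)} {v : Fin m → M.carrier} (h : M.Holds R v)
    (V : Fin n → M.carrier) (t : Fin m → Fin n) (e : V ∘ t = v) :
    M.Holds {w | w ∘ t ∈ R} V :=
  holds_comp t (e ▸ h)

theorem mem_internal_map₂ {A : Type} [IsStandard A] (f : Set A → Set A → Set A)
    (F : Prop → Prop → Prop) (hf : ∀ s t a, a ∈ f s t ↔ F (a ∈ s) (a ∈ t))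
    (x : M.Ext A) (S T : M.Ext (Set A)) :
    x ∈ M.internal (M.map₂ f S T) ↔ F (x ∈ M.internal S) (x ∈ M.internal T) := by
  classical
  have hg := pull (map₂_spec f S T) ![x.1, S.1, T.1, (M.map₂ f S T).1] ![1, 2, 3]
    (by ext i; fin_cases i <;> rfl)
  have hx := pull x.2 ![x.1, S.1, T.1, (M.map₂ f S T).1] ![0] (by ext i; fin_cases i; rfl)
  have hS : M.Holds {w : Fin 4 → StdObj | (w ∘ ![0, 1] ∈ {v : Fin 2 → StdObj |
      ∃ (a : A) (s : Set A), v = ![std a, std s] ∧ a ∈ s}) ↔ x ∈ M.internal S}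
      ![x.1, S.1, T.1, (M.map₂ f S T).1] := by
    by_cases h : x ∈ M.internal S
    · exact holds_mono (fun w hw => iff_of_true hw h)
        (pull (show M.Holds _ _ from h) _ ![0, 1] (by ext i; fin_cases i <;> rfl))
    · exact holds_mono (fun w hw => iff_of_false hw h)
        (pull (holds_compl (show ¬ M.Holds _ _ from h)) _ ![0, 1] (by ext i; fin_cases i <;> rfl))
  have hT : M.Holds {w : Fin 4 → StdObj | (w ∘ ![0, 2] ∈ {v : Fin 2 → StdObj |
      ∃ (a : A) (s : Set A), v = ![std a, std s] ∧ a ∈ s}) ↔ x ∈ M.internal T}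
      ![x.1, S.1, T.1, (M.map₂ f S T).1] := by
    by_cases h : x ∈ M.internal T
    · exact holds_mono (fun w hw => iff_of_true hw h)
        (pull (show M.Holds _ _ from h) _ ![0, 2] (by ext i; fin_cases i <;> rfl))
    · exact holds_mono (fun w hw => iff_of_false hw h)
        (pull (holds_compl (show ¬ M.Holds _ _ from h)) _ ![0, 2] (by ext i; fin_cases i <;> rfl))
  have hC : M.Holds {w : Fin 4 → StdObj | (w ∘ ![0, 3] ∈ {v : Fin 2 → StdObj |
      ∃ (a : A) (s : Set A), v = ![std a, std s] ∧ a ∈ s}) ↔ x ∈ M.internal (M.map₂ f S T)}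
      ![x.1, S.1, T.1, (M.map₂ f S T).1] := by
    by_cases h : x ∈ M.internal (M.map₂ f S T)
    · exact holds_mono (fun w hw => iff_of_true hw h)
        (pull (show M.Holds _ _ from h) _ ![0, 3] (by ext i; fin_cases i <;> rfl))
    · exact holds_mono (fun w hw => iff_of_false hw h)
        (pull (holds_compl (show ¬ M.Holds _ _ from h)) _ ![0, 3] (by ext i; fin_cases i <;> rfl))
  obtain ⟨w, ⟨⟨⟨w1, w2⟩, w3⟩, w4⟩, w5⟩ :=
    nonempty_of_holds (holds_inter (holds_inter (holds_inter (holds_inter hg hx) hS) hT) hC)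
  obtain ⟨s, t, c, hw, rfl⟩ := w1
  obtain ⟨a, ha⟩ := w2
  have ha : w 0 = std a := congrFun ha 0
  have hs : w 1 = std s := congrFun hw 0
  have ht : w 2 = std t := congrFun hw 1
  have hc : w 3 = std (f s t) := congrFun hw 2
  have key : ∀ (i : Fin 4) (s : Set A), w i = std s → ((w ∘ ![0, i] ∈ {v : Fin 2 → StdObj |
      ∃ (a : A) (s : Set A), v = ![std a, std s] ∧ a ∈ s}) ↔ a ∈ s) := by
    intro i s hi
    constructor
    · rintro ⟨a', s', h, h'⟩
      have e0 : w 0 = std a' := congrFun h 0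
      have e1 : w i = std s' := congrFun h 1
      rw [std_injective (ha.symm.trans e0), std_injective (hi.symm.trans e1)]
      exact h'
    · intro h
      refine ⟨a, s, ?_, h⟩
      ext j; fin_cases j
      · exact ha
      · exact hi
  have e1 := (key 1 s hs).symm.trans w3
  have e2 := (key 2 t ht).symm.trans w4
  have e3 := (key 3 _ hc).symm.trans w5
  rw [← e3, ← e1, ← e2, hf]

theorem standardPart_counting_add {S T : M.Ext (Set ℕ)} {p p₁ p₂ : ℝ}
    (h : M.IsStandardPart (counting k S) p)
    (h₁ : M.IsStandardPart (counting k (M.map₂ (· ∩ ·) S T)) p₁)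
    (h₂ : M.IsStandardPart (counting k (M.map₂ (· \ ·) S T)) p₂) : p₁ + p₂ = p := by
  by_contra hne
  have hε : 0 < |p₁ + p₂ - p| / 3 := by
    have := abs_pos.2 (sub_ne_zero.2 hne)
    positivity
  set ε := |p₁ + p₂ - p| / 3 with hεd
  have a₁ := pull (map₂_spec (· ∩ ·) S T) ![S.1, T.1, (M.map₂ (· ∩ ·) S T).1,
    (M.map₂ (· \ ·) S T).1, k.1, (counting k (M.map₂ (· ∩ ·) S T)).1,
    (counting k (M.map₂ (· \ ·) S T)).1, (counting k S).1] ![0, 1, 2]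
    (by ext i; fin_cases i <;> rfl)
  have a₂ := pull (map₂_spec (· \ ·) S T) ![S.1, T.1, (M.map₂ (· ∩ ·) S T).1,
    (M.map₂ (· \ ·) S T).1, k.1, (counting k (M.map₂ (· ∩ ·) S T)).1,
    (counting k (M.map₂ (· \ ·) S T)).1, (counting k S).1] ![0, 1, 3]
    (by ext i; fin_cases i <;> rfl)
  have b₁ := pull (map₂_spec proportion (M.map₂ (· ∩ ·) S T) k) ![S.1, T.1,
    (M.map₂ (· ∩ ·) S T).1,
    (M.map₂ (· \ ·) S T).1, k.1, (counting k (M.map₂ (· ∩ ·) S T)).1,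
    (counting k (M.map₂ (· \ ·) S T)).1, (counting k S).1] ![2, 4, 5]
    (by ext i; fin_cases i <;> rfl)
  have b₂ := pull (map₂_spec proportion (M.map₂ (· \ ·) S T) k) ![S.1, T.1,
    (M.map₂ (· ∩ ·) S T).1,
    (M.map₂ (· \ ·) S T).1, k.1, (counting k (M.map₂ (· ∩ ·) S T)).1,
    (counting k (M.map₂ (· \ ·) S T)).1, (counting k S).1] ![3, 4, 6]
    (by ext i; fin_cases i <;> rfl)
  have b := pull (map₂_spec proportion S k) ![S.1, T.1, (M.map₂ (· ∩ ·) S T).1,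
    (M.map₂ (· \ ·) S T).1, k.1, (counting k (M.map₂ (· ∩ ·) S T)).1,
    (counting k (M.map₂ (· \ ·) S T)).1, (counting k S).1] ![0, 4, 7]
    (by ext i; fin_cases i <;> rfl)
  have c₁ := pull (h₁ _ Metric.isOpen_ball (Metric.mem_ball_self hε)) ![S.1, T.1,
    (M.map₂ (· ∩ ·) S T).1,
    (M.map₂ (· \ ·) S T).1, k.1, (counting k (M.map₂ (· ∩ ·) S T)).1,
    (counting k (M.map₂ (· \ ·) S T)).1, (counting k S).1] ![5] (by ext i; fin_cases i; rfl)
  have c₂ := pull (h₂ _ Metric.isOpen_ball (Metric.mem_ball_self hε)) ![S.1, T.1,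
    (M.map₂ (· ∩ ·) S T).1,
    (M.map₂ (· \ ·) S T).1, k.1, (counting k (M.map₂ (· ∩ ·) S T)).1,
    (counting k (M.map₂ (· \ ·) S T)).1, (counting k S).1] ![6] (by ext i; fin_cases i; rfl)
  have c := pull (h _ Metric.isOpen_ball (Metric.mem_ball_self hε)) ![S.1, T.1,
    (M.map₂ (· ∩ ·) S T).1,
    (M.map₂ (· \ ·) S T).1, k.1, (counting k (M.map₂ (· ∩ ·) S T)).1,
    (counting k (M.map₂ (· \ ·) S T)).1, (counting k S).1] ![7] (by ext i; fin_cases i; rfl)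
  obtain ⟨w, ⟨⟨⟨⟨⟨⟨⟨wa₁, wa₂⟩, wb₁⟩, wb₂⟩, wb⟩, wc₁⟩, wc₂⟩, wc⟩⟩ := nonempty_of_holds
    (holds_inter (holds_inter (holds_inter (holds_inter (holds_inter (holds_inter
      (holds_inter a₁ a₂) b₁) b₂) b) c₁) c₂) c)
  obtain ⟨s, t, _, hw, rfl⟩ := wa₁
  have e0 : w 0 = std s := congrFun hw 0
  have e1 : w 1 = std t := congrFun hw 1
  have e2 : w 2 = std (s ∩ t) := congrFun hw 2
  obtain ⟨s', t', _, hw, rfl⟩ := wa₂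
  obtain rfl := std_injective (e0.symm.trans (congrFun hw 0))
  obtain rfl := std_injective (e1.symm.trans (congrFun hw 1))
  have e3 : w 3 = std (s \ t) := congrFun hw 2
  obtain ⟨s', n, _, hw, rfl⟩ := wb₁
  obtain rfl := std_injective (e2.symm.trans (congrFun hw 0))
  have e4 : w 4 = std n := congrFun hw 1
  have e5 : w 5 = std (proportion (s ∩ t) n) := congrFun hw 2
  obtain ⟨s', n', _, hw, rfl⟩ := wb₂
  obtain rfl := std_injective (e3.symm.trans (congrFun hw 0))
  obtain rfl := std_injective (e4.symm.trans (congrFun hw 1))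
  have e6 : w 6 = std (proportion (s \ t) n) := congrFun hw 2
  obtain ⟨s', n', _, hw, rfl⟩ := wb
  obtain rfl := std_injective (e0.symm.trans (congrFun hw 0))
  obtain rfl := std_injective (e4.symm.trans (congrFun hw 1))
  have e7 : w 7 = std (proportion s n) := congrFun hw 2
  obtain ⟨q₁, hw, hq₁⟩ := wc₁
  obtain rfl := std_injective (e5.symm.trans (congrFun hw 0))
  obtain ⟨q₂, hw, hq₂⟩ := wc₂
  obtain rfl := std_injective (e6.symm.trans (congrFun hw 0))
  obtain ⟨q, hw, hq⟩ := wc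
  obtain rfl := std_injective (e7.symm.trans (congrFun hw 0))
  rw [Metric.mem_ball, Real.dist_eq, abs_lt] at hq₁ hq₂ hq
  have hadd := proportion_add s t n
  have h3 : |p₁ + p₂ - p| < 3 * ε := by
    rw [abs_lt]
    constructor <;> linarith
  rw [hεd] at h3
  linarith

theorem le_caratheodory (k : M.Ext ℕ) :
    instMeasurableSpaceSeg ≤ (outer k).caratheodory := by
  refine MeasurableSpace.generateFrom_le ?_
  rintro _ ⟨T, rfl⟩
  refine OuterMeasure.boundedBy_caratheodory fun E => ?_
  refine le_iInf fun S => le_iInf fun hS => le_iInf fun p => le_iInf fun hp => ?_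
  obtain ⟨p₁, h0₁, h₁⟩ := exists_standardPart_counting (k := k) (M.map₂ (· ∩ ·) S T)
  obtain ⟨p₂, h0₂, h₂⟩ := exists_standardPart_counting (k := k) (M.map₂ (· \ ·) S T)
  have i₁ : internalSubset k (M.map₂ (· ∩ ·) S T) = E ∩ internalSubset k T := by
    rw [← hS]
    ext x
    exact mem_internal_map₂ (· ∩ ·) (fun a b => a ∧ b) (fun _ _ _ => Iff.rfl) x.1 S T
  have i₂ : internalSubset k (M.map₂ (· \ ·) S T) = E \ internalSubset k T := by
    rw [← hS]
    ext x
    exact mem_internal_map₂ (· \ ·) (fun a b => a ∧ ¬ b) (fun _ _ _ => Iff.rfl) x.1 S T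
  rw [← standardPart_counting_add hp h₁ h₂, ENNReal.ofReal_add h0₁ h0₂]
  refine add_le_add ?_ ?_
  · exact iInf_le_of_le _ (iInf_le_of_le i₁ (iInf_le_of_le p₁ (iInf_le_of_le h₁ le_rfl)))
  · exact iInf_le_of_le _ (iInf_le_of_le i₂ (iInf_le_of_le p₂ (iInf_le_of_le h₂ le_rfl)))

/-- The Loeb measure on `σ(𝔎)`. -/
noncomputable def loeb (k : M.Ext ℕ) : Measure (M.Seg k) :=
  (outer k).toMeasure (le_caratheodory k)

variable (M) in
/-- The Loeb space `(K, 𝔅)`: `𝔅` is the completion of `σ(𝔎)` with respect to the Loeb measure. The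
Loeb probability measure `P` on `𝔅` is `(loeb k).completion`. -/
abbrev LoebSpace (k : M.Ext ℕ) : Type u := NullMeasurableSpace (M.Seg k) (loeb k)

end Model

/-! ### Factors, the shift, typical points -/

/-- `Γ` exhibits the system `(Y, ν, S)` as a factor of `(X, μ, T)`: it is measurable and measure
preserving, and `Γ (T x) = S (Γ x)` for almost all `x`. -/
def IsFactorMap {X Y : Type*} [MeasurableSpace X] [MeasurableSpace Y] (μ : Measure X) (T : X → X)
    (ν : Measure Y) (S : Y → Y) (Γ : X → Y) : Prop :=
  MeasurePreserving Γ μ ν ∧ ∀ᵐ x ∂μ, Γ (T x) = S (Γ x)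

/-- The left shift on `[0,1]^ℕ`. -/
def shift (a : ℕ → I) : ℕ → I := fun n => a (n + 1)

/-- `α` is typical for `ρ`: Birkhoff averages of continuous functions along the orbit of `α`
converge to the integral. -/
def IsTypical (ρ : Measure (ℕ → I)) (α : ℕ → I) : Prop :=
  ∀ g : C(ℕ → I, ℝ), Tendsto (fun n : ℕ => (1 / (n : ℝ)) * ∑ i ∈ Finset.range n, g (shift^[i] α))
    atTop (𝓝 (∫ a, g a ∂ρ))

end Nonstandard

open scoped NNReal

/-! ### Comparison of probability measures, and Markov's inequality for orbit averages. -/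

namespace Nonstandard

universe u

/-! An element `x` of `*A` determines the ultrafilter `M.type x` of standard sets `U` with `x ∈ *U`.
Transfer then becomes a form of Łoś's theorem (`rel₂_map_map`, `map_mem_internal`,
`eventually_forall`): what holds of the elements `*f(z)` is what holds of `f a` for eventually all
`a` along the type of `z`. Standard parts become limits of standard functions along the type.
Compactness therefore gives `Γ`, and an infinite `k` has a type finer than `atTop`, so limits of
standard sequences can be evaluated at `k`.

Write `H n` for the `n`-th shift of `α`. For the image measure, let `F` be closed, `g ≥ 0`
continuous with `g ≥ 1` on `F`, and `0 < c < 1`. The preimage of `F` under `Γ` lies in the internal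
set `*{i | c < g (H i)}`. By Markov's inequality its counting measure is at most `1/c` times the
Birkhoff average of `g` at time `k`, which is infinitely close to `∫ g dρ` by typicality. Letting
`c` tend to 1 and `g` decrease to the indicator of `F` bounds the image measure of `F` by `ρ F`. For
two probability measures this one-sided bound forces equality.

So only an upper bound for the Loeb measure of internal sets is needed, together with total mass one
(`loeb_univ`). The latter is where saturation enters: countable internal covers of `K` reduce to
finite ones. Equivariance follows from continuity of the shift, except at `k - 1`, a null set. -/

/-- Two Borel probability measures are equal if the first is dominated on closed sets by the
integrals of continuous majorants against the second. -/
theorem measure_eq_of_forall_isClosed_le_lintegral {X : Type*} [TopologicalSpace X]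
    [TopologicalSpace.PseudoMetrizableSpace X] [MeasurableSpace X] [BorelSpace X]
    {π ρ : Measure X} [IsProbabilityMeasure π] [IsProbabilityMeasure ρ]
    (h : ∀ (F : Set X) (g : BoundedContinuousFunction X ℝ≥0), IsClosed F → (∀ x ∈ F, 1 ≤ g x) →
      π F ≤ ∫⁻ x, g x ∂ρ) : π = ρ := by
  have hF : ∀ F : Set X, IsClosed F → π F ≤ ρ F := fun F hF =>
    ge_of_tendsto' (HasOuterApproxClosed.tendsto_lintegral_apprSeq hF ρ) fun n =>
      h F _ hF fun x hx => (HasOuterApproxClosed.apprSeq_apply_eq_one hF n hx).ge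
  -- With equal total masses, domination on all measurable sets is equality; inner regularity by
  -- closed sets reduces domination to closed sets.
  refine Measure.eq_of_le_of_isProbabilityMeasure (Measure.le_iff.2 fun A hA => ?_)
  rw [hA.measure_eq_iSup_isClosed_of_ne_top (measure_ne_top π A)]
  exact iSup_le fun F => iSup_le fun hFA => iSup_le fun hFc => (hF F hFc).trans (measure_mono hFA)

/-- Markov's inequality for uniform counting on the first `n` integers. At `n = 0` both sides are
zero, by the convention for division. -/
theorem proportion_preimage_mul_le {X : Type*} {H : ℕ → X} {g : X → ℝ} (hg : ∀ x, 0 ≤ g x) {c : ℝ}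
    (n : ℕ) :
    c * Model.proportion {i | c < g (H i)} n ≤ (1 / (n : ℝ)) * ∑ i ∈ Finset.range n, g (H i) := by
  classical
  have hcard : ({i | c < g (H i)} ∩ Set.Iio n).ncard =
      ((Finset.range n).filter fun i => c < g (H i)).card := by
    rw [← Set.ncard_coe_finset]
    congr 1
    ext i
    simp [and_comm]
  rw [Model.proportion, hcard, ← mul_div_assoc, div_eq_mul_one_div, mul_comm (1 / (n : ℝ))]
  gcongr
  rw [mul_comm, ← nsmul_eq_mul]
  refine (Finset.card_nsmul_le_sum _ _ _ fun i hi => (Finset.mem_filter.1 hi).2.le).trans ?_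
  exact Finset.sum_le_sum_of_subset_of_nonneg (Finset.filter_subset _ _) fun i _ _ => hg _

theorem continuous_shift : Continuous shift := by
  unfold shift
  fun_prop

namespace Model

variable {M : Model.{u}}

/-! ### Types of nonstandard elements as ultrafilters -/

variable (M) in
/-- The complete type of a tuple `V`, as a filter on tuples of standard objects. -/
def tupleType {n : ℕ} (V : Fin n → M.carrier) : Filter (Fin n → StdObj) where
  sets := {R | M.Holds R V}
  univ_sets := by
    by_contra h
    obtain ⟨w, hw⟩ := nonempty_of_holds (holds_compl h)
    exact hw trivial
  sets_of_superset h hs := holds_mono hs h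
  inter_sets := holds_inter

instance tupleType_neBot {n : ℕ} (V : Fin n → M.carrier) : (M.tupleType V).NeBot :=
  ⟨fun h => by
    have : (∅ : Set (Fin n → StdObj)) ∈ M.tupleType V := h ▸ mem_bot
    exact (nonempty_of_holds this).ne_empty rfl⟩

/-- Facts about different subtuples are read along the type of one common tuple `V`, so that they
can be intersected as members of a single filter. -/
theorem holds_iff {m n : ℕ} {R : Set (Fin m → StdObj)} {v : Fin m → M.carrier}
    {V : Fin n → M.carrier} (t : Fin m → Fin n) (e : V ∘ t = v) :
    M.Holds R v ↔ ∀ᶠ w in M.tupleType V, w ∘ t ∈ R :=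
  ⟨fun h => pull h V t e, fun h => e ▸ holds_of_comp t h⟩

section Filters

variable {A B C D : Type} [IsStandard A] [IsStandard B] [IsStandard C] [IsStandard D]

theorem ext_iff_eventually {n : ℕ} {V : Fin n → M.carrier} {i : Fin n} {x : M.Ext A}
    (hx : V i = x.1) : ∀ᶠ w in M.tupleType V, ∃ a : A, w i = std a := by
  have := (holds_iff (V := V) ![i] (by ext j; fin_cases j; exact hx)).1 x.2
  filter_upwards [this] with w ⟨a, ha⟩
  exact ⟨a, congrFun ha 0⟩

theorem rel₁_iff {n : ℕ} {V : Fin n → M.carrier} {i : Fin n} {R : A → Prop} {x : M.Ext A}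
    (hx : V i = x.1) : M.Rel₁ R x ↔ ∀ᶠ w in M.tupleType V, ∃ a, w i = std a ∧ R a := by
  rw [Rel₁, holds_iff (V := V) ![i] (by ext j; fin_cases j; exact hx)]
  refine eventually_congr (Eventually.of_forall fun w => ?_)
  refine exists_congr fun a => and_congr_left fun _ => ⟨fun h => congrFun h 0, fun h => ?_⟩
  ext j; fin_cases j; exact h

theorem rel₂_iff {n : ℕ} {V : Fin n → M.carrier} {i j : Fin n} {R : A → B → Prop} {x : M.Ext A}
    {y : M.Ext B} (hx : V i = x.1) (hy : V j = y.1) :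
    M.Rel₂ R x y ↔ ∀ᶠ w in M.tupleType V, ∃ a b, (w i = std a ∧ w j = std b) ∧ R a b := by
  rw [Rel₂, holds_iff (V := V) ![i, j] (by ext l; fin_cases l; exacts [hx, hy])]
  refine eventually_congr (Eventually.of_forall fun w => ?_)
  refine exists_congr fun a => exists_congr fun b => and_congr_left fun _ =>
    ⟨fun h => ⟨congrFun h 0, congrFun h 1⟩, fun h => ?_⟩
  ext l; fin_cases l; exacts [h.1, h.2]

theorem rel₃_iff {n : ℕ} {V : Fin n → M.carrier} {i j l : Fin n} {R : A → B → C → Prop}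
    {x : M.Ext A} {y : M.Ext B} {z : M.Ext C} (hx : V i = x.1) (hy : V j = y.1) (hz : V l = z.1) :
    M.Rel₃ R x y z ↔ ∀ᶠ w in M.tupleType V,
      ∃ a b c, (w i = std a ∧ w j = std b ∧ w l = std c) ∧ R a b c := by
  rw [Rel₃, holds_iff (V := V) ![i, j, l] (by ext s; fin_cases s; exacts [hx, hy, hz])]
  refine eventually_congr (Eventually.of_forall fun w => ?_)
  refine exists_congr fun a => exists_congr fun b => exists_congr fun c => and_congr_left fun _ =>
    ⟨fun h => ⟨congrFun h 0, congrFun h 1, congrFun h 2⟩, fun h => ?_⟩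
  ext s; fin_cases s; exacts [h.1, h.2.1, h.2.2]

/-- Equality in the model is the logical symbol, whereas `Holds` interprets relation symbols;
transferring an implication between the two connects them. -/
theorem eq_of_eventually {n : ℕ} {V : Fin n → M.carrier} {i j : Fin n}
    (h : ∀ᶠ w in M.tupleType V, w i = w j) : V i = V j := by
  have := M.transfer ((atom {w : Fin n → StdObj | w i = w j} id).imp
    (FirstOrder.Language.Term.bdEqual (FirstOrder.Language.Term.var (Sum.inr i))
      (FirstOrder.Language.Term.var (Sum.inr j)))) (fun w => by
        rw [FirstOrder.Language.BoundedFormula.realize_imp]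
        intro hw
        have : w i = w j := hw
        simpa using this) V h
  simpa using this

variable (M) in
/-- The ultrafilter `{U ⊆ A | x ∈ *U}` of an element `x` of `*A`. -/
def type (x : M.Ext A) : Ultrafilter A :=
  Ultrafilter.ofComplNotMemIff
    { sets := {U | M.Rel₁ (· ∈ U) x}
      univ_sets := by
        refine (rel₁_iff (V := ![x.1]) (i := 0) rfl).2 ?_
        filter_upwards [ext_iff_eventually (V := ![x.1]) (i := 0) rfl] with w ⟨a, ha⟩
        exact ⟨a, ha, trivial⟩
      sets_of_superset := by
        intro U U' h hs
        refine (rel₁_iff (V := ![x.1]) (i := 0) rfl).2 ?_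
        filter_upwards [(rel₁_iff (V := ![x.1]) (i := 0) rfl).1 h] with w ⟨a, ha, h⟩
        exact ⟨a, ha, hs h⟩
      inter_sets := by
        intro U U' h h'
        refine (rel₁_iff (V := ![x.1]) (i := 0) rfl).2 ?_
        filter_upwards [(rel₁_iff (V := ![x.1]) (i := 0) rfl).1 h,
          (rel₁_iff (V := ![x.1]) (i := 0) rfl).1 h'] with w ⟨a, ha, h⟩ ⟨b, hb, h'⟩
        obtain rfl := std_injective (ha.symm.trans hb)
        exact ⟨a, ha, h, h'⟩ }
    (by
      intro U
      constructor
      · intro h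
        have h' : ¬ M.Holds _ _ := h
        have h2 : M.Holds _ _ := holds_compl h'
        have h3 : ∀ᶠ w in M.tupleType ![x.1], ¬ ∃ a, w = ![std a] ∧ a ∈ Uᶜ := h2
        refine (rel₁_iff (V := ![x.1]) (i := 0) rfl).2 ?_
        filter_upwards [h3, ext_iff_eventually (V := ![x.1]) (i := 0) rfl] with w hw ⟨a, ha⟩
        refine ⟨a, ha, ?_⟩
        by_contra hU
        refine hw ⟨a, ?_, hU⟩
        ext j; fin_cases j; exact ha
      · intro h h'
        obtain ⟨w, ⟨a, ha, h⟩, b, hb, h'⟩ :=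
          (((rel₁_iff (V := ![x.1]) (i := 0) rfl).1 h).and
            ((rel₁_iff (V := ![x.1]) (i := 0) rfl).1 h')).exists
        obtain rfl := std_injective (ha.symm.trans hb)
        exact h' h)

theorem eventually_type_iff {n : ℕ} {V : Fin n → M.carrier} {i : Fin n} {R : A → Prop}
    {x : M.Ext A} (hx : V i = x.1) :
    (∀ᶠ a in M.type x, R a) ↔ ∀ᶠ w in M.tupleType V, ∃ a, w i = std a ∧ R a := rel₁_iff hx

theorem isStandardPart_iff [TopologicalSpace A] {x : M.Ext A} {p : A} :
    M.IsStandardPart x p ↔ (M.type x : Filter A) ≤ 𝓝 p := by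
  rw [(nhds_basis_opens p).ge_iff]
  exact ⟨fun h U hU => h U hU.2 hU.1, fun h U hU hp => h U ⟨hp, hU⟩⟩

/-- The transformed graph is single-valued. This makes `map`, defined by choice, computable. -/
theorem eq_map_of_rel₂ {f : A → B} {x : M.Ext A} {y : M.Ext B}
    (h : M.Rel₂ (fun a b => f a = b) x y) : y = M.map f x := by
  have h1 := (rel₂_iff (V := ![x.1, y.1, (M.map f x).1]) (i := 0) (j := 1) rfl rfl).1 h
  have h2 := (rel₂_iff (V := ![x.1, y.1, (M.map f x).1]) (i := 0) (j := 2) rfl rfl).1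
    (map_spec f x)
  refine Subtype.ext (eq_of_eventually (V := ![x.1, y.1, (M.map f x).1]) (i := 1) (j := 2) ?_)
  filter_upwards [h1, h2] with w ⟨a, b, ⟨ha, hb⟩, h⟩ ⟨a', b', ⟨ha', hb'⟩, h'⟩
  obtain rfl := std_injective (ha.symm.trans ha')
  rw [hb, hb', ← h, ← h']

theorem map_map (g : B → C) (f : A → B) (x : M.Ext A) :
    M.map g (M.map f x) = M.map (fun a => g (f a)) x := by
  let V := ![x.1, (M.map f x).1, (M.map g (M.map f x)).1]
  refine eq_map_of_rel₂ ((rel₂_iff (V := V) (i := 0) (j := 2) rfl rfl).2 ?_)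
  filter_upwards [(rel₂_iff (V := V) (i := 0) (j := 1) rfl rfl).1 (map_spec f x),
    (rel₂_iff (V := V) (i := 1) (j := 2) rfl rfl).1 (map_spec g (M.map f x))]
    with w ⟨a, b, ⟨ha, hb⟩, h⟩ ⟨b', c, ⟨hb', hc⟩, h'⟩
  obtain rfl := std_injective (hb.symm.trans hb')
  exact ⟨a, c, ⟨ha, hc⟩, by rw [h, h']⟩

theorem map_id (x : M.Ext A) : M.map (fun a => a) x = x := by
  refine (eq_map_of_rel₂ ((rel₂_iff (V := ![x.1]) (i := 0) (j := 0) rfl rfl).2 ?_)).symm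
  filter_upwards [ext_iff_eventually (V := ![x.1]) (i := 0) rfl] with w ⟨a, ha⟩
  exact ⟨a, a, ⟨ha, ha⟩, rfl⟩

theorem map_const (b : B) (x : M.Ext A) : M.map (fun _ => b) x = M.const b := by
  refine (eq_map_of_rel₂
    ((rel₂_iff (V := ![x.1, (M.const b).1]) (i := 0) (j := 1) rfl rfl).2 ?_)).symm
  have hb : M.Rel₁ (· = b) (M.const b) := by
    have h : M.Holds {v : Fin 1 → StdObj | ∃ a : B, v = ![std a] ∧ a = b} (M.emb ∘ ![std b]) :=
      holds_std ⟨b, rfl, rfl⟩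
    rw [Rel₁]
    convert! h using 1
    ext i
    fin_cases i
    rfl
  filter_upwards [ext_iff_eventually (V := ![x.1, (M.const b).1]) (i := 0) rfl,
    (rel₁_iff (V := ![x.1, (M.const b).1]) (i := 1) rfl).1 hb] with w ⟨a, ha⟩ ⟨b', hb', h⟩
  exact ⟨a, b', ⟨ha, hb'⟩, h.symm⟩

theorem type_map (f : A → B) (x : M.Ext A) : M.type (M.map f x) = (M.type x).map f := by
  refine Ultrafilter.coe_le_coe.1 fun U hU => ?_
  have hU : ∀ᶠ a in M.type x, f a ∈ U := hU
  let V := ![x.1, (M.map f x).1]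
  refine (eventually_type_iff (V := V) (i := 1) rfl).2 ?_
  filter_upwards [(rel₂_iff (V := V) (i := 0) (j := 1) rfl rfl).1 (map_spec f x),
    (eventually_type_iff (V := V) (i := 0) rfl).1 hU] with w ⟨a, b, ⟨ha, hb⟩, h⟩ ⟨a', ha', h'⟩
  obtain rfl := std_injective (ha.symm.trans ha')
  exact ⟨b, hb, h ▸ h'⟩

theorem map₂_map_map (h : B → C → D) (f : A → B) (g : A → C) (x : M.Ext A) :
    M.map₂ h (M.map f x) (M.map g x) = M.map (fun a => h (f a) (g a)) x := by
  let V := ![x.1, (M.map f x).1, (M.map g x).1, (M.map₂ h (M.map f x) (M.map g x)).1]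
  refine eq_map_of_rel₂ ((rel₂_iff (V := V) (i := 0) (j := 3) rfl rfl).2 ?_)
  filter_upwards [(rel₂_iff (V := V) (i := 0) (j := 1) rfl rfl).1 (map_spec f x),
    (rel₂_iff (V := V) (i := 0) (j := 2) rfl rfl).1 (map_spec g x),
    (rel₃_iff (V := V) (i := 1) (j := 2) (l := 3) rfl rfl rfl).1 (map₂_spec h _ _)]
    with w ⟨a, b, ⟨ha, hb⟩, h1⟩ ⟨a', c, ⟨ha', hc⟩, h2⟩ ⟨b', c', d, ⟨hb', hc', hd⟩, h3⟩
  obtain rfl := std_injective (ha.symm.trans ha')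
  obtain rfl := std_injective (hb.symm.trans hb')
  obtain rfl := std_injective (hc.symm.trans hc')
  exact ⟨a, d, ⟨ha, hd⟩, by rw [h1, h2, h3]⟩

/-- Łoś's theorem for two elements with a common parameter; by `exists_pair`, any two elements can
be brought to this form. -/
theorem rel₂_map_map {R : B → C → Prop} {f : A → B} {g : A → C} {x : M.Ext A} :
    M.Rel₂ R (M.map f x) (M.map g x) ↔ ∀ᶠ a in M.type x, R (f a) (g a) := by
  let V := ![x.1, (M.map f x).1, (M.map g x).1]
  rw [rel₂_iff (V := V) (i := 1) (j := 2) rfl rfl, eventually_type_iff (V := V) (i := 0) rfl]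
  refine eventually_congr ?_
  filter_upwards [(rel₂_iff (V := V) (i := 0) (j := 1) rfl rfl).1 (map_spec f x),
    (rel₂_iff (V := V) (i := 0) (j := 2) rfl rfl).1 (map_spec g x)]
    with w ⟨a, b, ⟨ha, hb⟩, h1⟩ ⟨a', c, ⟨ha', hc⟩, h2⟩
  obtain rfl := std_injective (ha.symm.trans ha')
  subst h1 h2
  constructor
  · rintro ⟨b', c', ⟨hb', hc'⟩, h⟩
    obtain rfl := std_injective (hb.symm.trans hb')
    obtain rfl := std_injective (hc.symm.trans hc')
    exact ⟨a, ha, h⟩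
  · rintro ⟨a', ha', h⟩
    obtain rfl := std_injective (ha.symm.trans ha')
    exact ⟨_, _, ⟨hb, hc⟩, h⟩

/-- Any two elements are the images of a single element under standard maps. -/
theorem exists_pair (x : M.Ext A) (y : M.Ext B) :
    ∃ z : M.Ext (A × B), x = M.map Prod.fst z ∧ y = M.map Prod.snd z := by
  let z := M.map₂ Prod.mk x y
  let V := ![x.1, y.1, z.1]
  have h := (rel₃_iff (V := V) (i := 0) (j := 1) (l := 2) rfl rfl rfl).1 (map₂_spec Prod.mk x y)
  refine ⟨z, eq_map_of_rel₂ ((rel₂_iff (V := V) (i := 2) (j := 0) rfl rfl).2 ?_),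
    eq_map_of_rel₂ ((rel₂_iff (V := V) (i := 2) (j := 1) rfl rfl).2 ?_)⟩
  · filter_upwards [h] with w ⟨a, b, c, ⟨ha, hb, hc⟩, h⟩
    exact ⟨c, a, ⟨hc, ha⟩, by rw [← h]⟩
  · filter_upwards [h] with w ⟨a, b, c, ⟨ha, hb, hc⟩, h⟩
    exact ⟨c, b, ⟨hc, hb⟩, by rw [← h]⟩

end Filters

/-! ### Internal sets with parameters. -/

section Definability

variable {A B C : Type} [IsStandard A] [IsStandard B] [IsStandard C]

theorem exists_triple (x : M.Ext A) (y : M.Ext B) (z : M.Ext C) :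
    ∃ t : M.Ext (A × B × C), x = M.map (fun a => a.1) t ∧ y = M.map (fun a => a.2.1) t ∧
      z = M.map (fun a => a.2.2) t := by
  obtain ⟨s, rfl, rfl⟩ := exists_pair y z
  obtain ⟨t, rfl, rfl⟩ := exists_pair x s
  exact ⟨t, rfl, map_map _ _ _, map_map _ _ _⟩

theorem map_mem_internal {f : A → B} {S : A → Set B} {z : M.Ext A} :
    M.map f z ∈ M.internal (M.map S z) ↔ ∀ᶠ a in M.type z, f a ∈ S a :=
  rel₂_map_map

theorem mem_internal_const {x : M.Ext A} {S : Set A} :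
    x ∈ M.internal (M.const S) ↔ ∀ᶠ a in M.type x, a ∈ S := by
  have := map_mem_internal (f := fun a => a) (S := fun _ => S) (z := x)
  rwa [map_id, map_const] at this

end Definability

/-- Transfer for formulas `∀ x : B, R a x`. -/
theorem eventually_forall {A B : Type} [IsStandard A] {R : A → B → Prop} {z : M.Ext A}
    (h : ∀ f : A → B, ∀ᶠ a in M.type z, R a (f a)) : ∀ᶠ a in M.type z, ∀ b, R a b := by
  by_contra hne
  rw [← Ultrafilter.eventually_not] at hne
  simp only [not_forall] at hne
  obtain ⟨a₀, b₀, -⟩ := hne.exists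
  have : Nonempty B := ⟨b₀⟩
  -- A Skolem function: the counterexamples are collected into one standard `f`, to which the
  -- hypothesis applies.
  obtain ⟨f, hf⟩ := hne.choice
  obtain ⟨a, h1, h2⟩ := (hf.and (h f)).exists
  exact h1 h2

/-! ### The internal counting measure -/

section Counting

variable {A : Type} [IsStandard A]

/-- This is how asymptotics enter: a limit at infinity is also a limit along the type of `k`. -/
theorem Infinite.type_le_atTop {k : M.Ext ℕ} (hk : M.Infinite k) :
    (M.type k : Filter ℕ) ≤ atTop := by
  rw [atTop_basis_Ioi.ge_iff]
  intro n _
  have h := hk n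
  rw [← map_const n k] at h
  nth_rw 2 [← map_id k] at h
  exact rel₂_map_map.1 h

theorem isStandardPart_map_iff {B : Type} [IsStandard B] [TopologicalSpace B] {f : A → B}
    {z : M.Ext A} {p : B} : M.IsStandardPart (M.map f z) p ↔ Tendsto f (M.type z) (𝓝 p) := by
  rw [isStandardPart_iff, type_map, Ultrafilter.coe_map]
  rfl

theorem isStandardPart_counting_iff {κ : A → ℕ} {S : A → Set ℕ} {z : M.Ext A} {p : ℝ} :
    M.IsStandardPart (counting (M.map κ z) (M.map S z)) p ↔
      Tendsto (fun a => proportion (S a) (κ a)) (M.type z) (𝓝 p) := by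
  rw [counting, map₂_map_map, isStandardPart_map_iff]

theorem isStandardPart_counting_const_iff {k : M.Ext ℕ} {S : Set ℕ} {p : ℝ} :
    M.IsStandardPart (counting k (M.const S)) p ↔
      Tendsto (proportion S) (M.type k) (𝓝 p) := by
  have := isStandardPart_counting_iff (κ := fun n => n) (S := fun _ => S) (z := k) (p := p)
  rwa [map_id, map_const] at this

theorem proportion_mono {S T : Set ℕ} {n : ℕ} (h : ∀ x, x < n → x ∈ S → x ∈ T) :
    proportion S n ≤ proportion T n := by
  unfold proportion
  gcongr ?_ / _
  have hsub : S ∩ Set.Iio n ⊆ T ∩ Set.Iio n := fun x hx => ⟨h x hx.2 hx.1, hx.2⟩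
  exact_mod_cast Set.ncard_le_ncard hsub ((Set.finite_Iio n).subset Set.inter_subset_right)

theorem proportion_union_le (S T : Set ℕ) (n : ℕ) :
    proportion (S ∪ T) n ≤ proportion S n + proportion T n := by
  unfold proportion
  rw [← add_div, Set.union_inter_distrib_right]
  gcongr ?_ / _
  exact_mod_cast Set.ncard_union_le _ _

/-- Inclusion of the subsets of `K` forces inclusion below `k` of the representing standard sets
along the type. In particular the standard part of the counting measure depends only on the subset
of `K`, not on its representative. -/
theorem standardPart_counting_mono {k : M.Ext ℕ} {S T : M.Ext (Set ℕ)} {p q : ℝ}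
    (h : internalSubset k S ⊆ internalSubset k T) (hp : M.IsStandardPart (counting k S) p)
    (hq : M.IsStandardPart (counting k T) q) : p ≤ q := by
  obtain ⟨z, rfl, rfl, rfl⟩ := exists_triple S T k
  rw [isStandardPart_counting_iff] at hp hq
  refine le_of_tendsto_of_tendsto hp hq ?_
  have : ∀ᶠ a : Set ℕ × Set ℕ × ℕ in M.type z, ∀ x : ℕ, x < a.2.2 → x ∈ a.1 → x ∈ a.2.1 := by
    refine eventually_forall fun f => ?_
    rw [Ultrafilter.eventually_imp, Ultrafilter.eventually_imp]
    intro h1 h2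
    -- A standard choice `f` of points of the smaller set defines a genuine point of `K`, to which
    -- the external inclusion applies.
    let x : M.Seg (M.map (fun a : Set ℕ × Set ℕ × ℕ => a.2.2) z) :=
      ⟨M.map f z, rel₂_map_map.2 h1⟩
    have hx : x ∈ internalSubset _ (M.map (fun a : Set ℕ × Set ℕ × ℕ => a.1) z) :=
      map_mem_internal.2 h2
    exact map_mem_internal.1 (h hx)
  filter_upwards [this] with a ha using proportion_mono ha

theorem exists_union {k : M.Ext ℕ} (S T : M.Ext (Set ℕ)) : ∃ U : M.Ext (Set ℕ),
    internalSubset k U = internalSubset k S ∪ internalSubset k T ∧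
    ∀ p q r, M.IsStandardPart (counting k S) p → M.IsStandardPart (counting k T) q →
      M.IsStandardPart (counting k U) r → r ≤ p + q := by
  refine ⟨M.map₂ (· ∪ ·) S T, ?_, ?_⟩
  · ext x
    exact mem_internal_map₂ (· ∪ ·) (fun a b => a ∨ b) (fun _ _ _ => Iff.rfl) x.1 S T
  · obtain ⟨z, rfl, rfl, rfl⟩ := exists_triple S T k
    intro p q r hp hq hr
    rw [map₂_map_map] at hr
    rw [isStandardPart_counting_iff] at hp hq hr
    exact le_of_tendsto_of_tendsto hr (hp.add hq)
      (Eventually.of_forall fun _ => proportion_union_le _ _ _)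

theorem internalSubset_const_univ {k : M.Ext ℕ} :
    internalSubset k (M.const Set.univ) = Set.univ :=
  Set.eq_univ_of_forall fun _ => mem_internal_const.2 univ_mem

theorem internalSubset_const_empty {k : M.Ext ℕ} :
    internalSubset k (M.const ∅) = ∅ := by
  refine Set.eq_empty_of_forall_notMem fun x hx => ?_
  obtain ⟨a, ha⟩ := (mem_internal_const.1 hx).exists
  exact ha

theorem isStandardPart_counting_univ {k : M.Ext ℕ} (hk : M.Infinite k) :
    M.IsStandardPart (counting k (M.const Set.univ)) 1 := by
  rw [isStandardPart_counting_const_iff]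
  refine (tendsto_const_nhds.congr' ?_).mono_left hk.type_le_atTop
  -- The value at `n = 0` is `0 / 0 = 0` and must be discarded.
  filter_upwards [eventually_gt_atTop 0] with n hn
  have : (n : ℝ) ≠ 0 := by positivity
  simp [proportion, Set.ncard_eq_toFinset_card', this]

theorem isStandardPart_counting_empty {k : M.Ext ℕ} :
    M.IsStandardPart (counting k (M.const ∅)) 0 := by
  rw [isStandardPart_counting_const_iff]
  refine tendsto_const_nhds.congr fun n => ?_
  simp [proportion]

/-- A countable cover of `K` by internal sets has a finite subcover. -/
theorem Saturated.exists_finite_subcover (hM : M.Saturated) {k : M.Ext ℕ} {S : ℕ → M.Ext (Set ℕ)}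
    (h : ⋃ n, internalSubset k (S n) = Set.univ) :
    ∃ N, ⋃ n ∈ Set.Iic N, internalSubset k (S n) = Set.univ := by
  by_contra! hne
  -- `*Iio` at `k` is `K` itself, so `T n` is the complement of `S n` in `K`. Without a finite
  -- subcover, these complements have the finite intersection property.
  let T : ℕ → M.Ext (Set ℕ) := fun n => M.map₂ (· \ ·) (M.map Set.Iio k) (S n)
  have hT : ∀ n x, x ∈ M.internal (T n) ↔ M.Rel₂ (· < ·) x k ∧ x ∉ M.internal (S n) := by
    intro n x
    rw [show x ∈ M.internal (T n) ↔ x ∈ M.internal (M.map Set.Iio k) ∧ x ∉ M.internal (S n) from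
      mem_internal_map₂ (· \ ·) (fun a b => a ∧ ¬ b) (fun _ _ _ => Iff.rfl) x _ _]
    refine and_congr_left fun _ => ?_
    obtain ⟨z, rfl, rfl⟩ := exists_pair x k
    rw [map_map, map_mem_internal, rel₂_map_map]
    rfl
  obtain ⟨x, hx⟩ := hM ℕ T fun N => by
    obtain ⟨x, hx⟩ := (Set.ne_univ_iff_exists_notMem _).1 (hne N)
    refine ⟨x.1, Set.mem_iInter₂.2 fun n hn => (hT n x.1).2 ⟨x.2, fun hS => hx ?_⟩⟩
    exact Set.mem_biUnion (Set.mem_Iic.2 hn) hS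
  rw [Set.mem_iInter] at hx
  have hxk := ((hT 0 x).1 (hx 0)).1
  obtain ⟨n, hn⟩ := Set.mem_iUnion.1 (h.ge (Set.mem_univ (⟨x, hxk⟩ : M.Seg k)))
  exact ((hT n x).1 (hx n)).2 hn

theorem exists_biUnion {k : M.Ext ℕ} {S : ℕ → M.Ext (Set ℕ)} {p : ℕ → ℝ}
    (hp : ∀ n, M.IsStandardPart (counting k (S n)) (p n)) (N : ℕ) :
    ∃ U : M.Ext (Set ℕ), internalSubset k U = ⋃ n ∈ Set.Iio N, internalSubset k (S n) ∧
      ∃ r, M.IsStandardPart (counting k U) r ∧ r ≤ ∑ n ∈ Finset.range N, p n := by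
  induction N with
  | zero => exact ⟨M.const ∅, by simp [internalSubset_const_empty], 0,
      isStandardPart_counting_empty, by simp⟩
  | succ N ih =>
    obtain ⟨U, hU, r, hr, hle⟩ := ih
    obtain ⟨V, hV, hsub⟩ := exists_union (k := k) U (S N)
    obtain ⟨s, -, hs⟩ := exists_standardPart_counting (k := k) V
    refine ⟨V, ?_, s, hs, ?_⟩
    · rw [hV, hU, ← Order.succ_eq_add_one, Order.Iio_succ_eq_insert, Set.biUnion_insert,
        Set.union_comm]
    · rw [Finset.sum_range_succ]
      linarith [hsub r (p N) s hr (hp N) hs]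

end Counting

/-! ### The Loeb measure -/

section Loeb

variable {k : M.Ext ℕ}

theorem measurableSet_internalSubset (S : M.Ext (Set ℕ)) : MeasurableSet (internalSubset k S) :=
  MeasurableSpace.measurableSet_generateFrom ⟨S, rfl⟩

theorem loeb_internalSubset_le {S : M.Ext (Set ℕ)} {p : ℝ}
    (hp : M.IsStandardPart (counting k S) p) :
    loeb k (internalSubset k S) ≤ ENNReal.ofReal p := by
  rw [loeb, toMeasure_apply _ _ (measurableSet_internalSubset S)]
  refine (OuterMeasure.boundedBy_le _).trans ?_
  exact iInf_le_of_le S (iInf_le_of_le rfl (iInf_le_of_le p (iInf_le_of_le hp le_rfl)))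

theorem loeb_univ (hM : M.Saturated) (hk : M.Infinite k) : loeb k Set.univ = 1 := by
  refine le_antisymm ?_ ?_
  · simpa [internalSubset_const_univ] using
      loeb_internalSubset_le (isStandardPart_counting_univ hk)
  rw [loeb, toMeasure_apply _ _ MeasurableSet.univ, outer, OuterMeasure.boundedBy_apply]
  refine le_iInf fun t => le_iInf fun ht => ?_
  -- A nonempty non-internal set has infinite content; outside this trivial case every member of the
  -- cover is internal.
  by_cases htop : ∃ n, ⨆ _ : (t n).Nonempty, content k (t n) = ⊤
  · obtain ⟨n, hn⟩ := htop
    exact le_top.trans (hn.symm.le.trans (ENNReal.le_tsum n))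
  push Not at htop
  have key : ∀ n, ∃ (S : M.Ext (Set ℕ)) (p : ℝ), internalSubset k S = t n ∧ 0 ≤ p ∧
      M.IsStandardPart (counting k S) p ∧
      ENNReal.ofReal p ≤ ⨆ _ : (t n).Nonempty, content k (t n) := by
    intro n
    by_cases hn : (t n).Nonempty
    · have hlt := (htop n).lt_top
      rw [iSup_pos hn, content] at hlt
      simp only [iInf_lt_iff] at hlt
      obtain ⟨S, hS, -, -, -⟩ := hlt
      obtain ⟨p, hp0, hp⟩ := exists_standardPart_counting (k := k) S
      refine ⟨S, p, hS, hp0, hp, ?_⟩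
      rw [iSup_pos hn, content]
      -- `content` is an infimum over all representatives; monotonicity shows that the chosen one
      -- already attains it.
      refine le_iInf fun S' => le_iInf fun hS' => le_iInf fun p' => le_iInf fun hp' => ?_
      exact ENNReal.ofReal_le_ofReal (standardPart_counting_mono (hS.trans hS'.symm).le hp hp')
    · refine ⟨M.const ∅, 0, ?_, le_rfl, isStandardPart_counting_empty, by simp⟩
      rw [internalSubset_const_empty, Set.not_nonempty_iff_eq_empty.1 hn]
  choose S p hS hp0 hp hle using key
  obtain ⟨N, hN⟩ := hM.exists_finite_subcover (k := k) (S := S)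
    (Set.univ_subset_iff.1 (by simpa only [hS] using ht))
  obtain ⟨U, hU, r, hr, hrle⟩ := exists_biUnion hp (N + 1)
  rw [show Set.Iio (N + 1) = Set.Iic N by ext; simp, hN] at hU
  have h1 : 1 ≤ r := standardPart_counting_mono (by rw [hU]; exact Set.subset_univ _)
    (isStandardPart_counting_univ hk) hr
  calc (1 : ℝ≥0∞) = ENNReal.ofReal 1 := by simp
    _ ≤ ENNReal.ofReal (∑ n ∈ Finset.range (N + 1), p n) :=
      ENNReal.ofReal_le_ofReal (h1.trans hrle)
    _ = ∑ n ∈ Finset.range (N + 1), ENNReal.ofReal (p n) :=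
      ENNReal.ofReal_sum_of_nonneg fun n _ => hp0 n
    _ ≤ ∑ n ∈ Finset.range (N + 1), ⨆ _ : (t n).Nonempty, content k (t n) :=
      Finset.sum_le_sum fun n _ => hle n
    _ ≤ _ := ENNReal.sum_le_tsum _

end Loeb

variable {k : M.Ext ℕ}

/-! ### The standard part map of a sequence in a compact space, and its image measure. -/

section StandardPartMap

variable {X : Type} [IsStandard X] [TopologicalSpace X]

/-- In a compact space the image ultrafilter converges. -/
theorem exists_isStandardPart_map [CompactSpace X] (H : ℕ → X) (x : M.Ext ℕ) :
    ∃ p, M.IsStandardPart (M.map H x) p :=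
  ⟨((M.type x).map H).lim, by
    rw [isStandardPart_iff, type_map]
    exact Ultrafilter.le_nhds_lim _⟩

theorem isStandardPart_unique [T2Space X] {x : M.Ext X} {p q : X} (hp : M.IsStandardPart x p)
    (hq : M.IsStandardPart x q) : p = q :=
  eq_of_nhds_neBot (NeBot.mono (M.type x).neBot
    (le_inf (isStandardPart_iff.1 hp) (isStandardPart_iff.1 hq)))

variable {H : ℕ → X} {Γ : M.Seg k → X}

/-- A sublevel set is a countable intersection of internal sets. The slack `1 / (j + 1)` is needed
because strict inequalities survive in limits only as weak ones. -/
theorem measurable_comp_standardPart (hΓ : ∀ x, M.IsStandardPart (M.map H x.1) (Γ x))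
    {g : X → ℝ} (hg : Continuous g) : Measurable fun x => g (Γ x) := by
  refine measurable_of_Iic fun c => ?_
  have hlim : ∀ x : M.Seg k, Tendsto (fun n => g (H n)) (M.type x.1) (𝓝 (g (Γ x))) := fun x =>
    (hg.tendsto _).comp (isStandardPart_map_iff.1 (hΓ x))
  have : (fun x => g (Γ x)) ⁻¹' Set.Iic c =
      ⋂ j : ℕ, internalSubset k (M.const {n | g (H n) < c + 1 / ((j : ℝ) + 1)}) := by
    ext x
    simp only [Set.mem_preimage, Set.mem_Iic, Set.mem_iInter]
    constructor
    · intro hx j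
      refine mem_internal_const.2 ((hlim x).eventually_lt_const ?_)
      have : 0 < 1 / ((j : ℝ) + 1) := by positivity
      linarith
    · intro hx
      have hc : Tendsto (fun j : ℕ => c + 1 / ((j : ℝ) + 1)) atTop (𝓝 (c + 0)) :=
        tendsto_const_nhds.add tendsto_one_div_add_atTop_nhds_zero_nat
      rw [add_zero] at hc
      refine ge_of_tendsto' hc fun j => ?_
      exact le_of_tendsto (hlim x) ((mem_internal_const.1 (hx j)).mono fun n hn => le_of_lt hn)
  rw [this]
  exact MeasurableSet.iInter fun j => measurableSet_internalSubset _

theorem loeb_preimage_le (hk : M.Infinite k)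
    (hΓ : ∀ x, M.IsStandardPart (M.map H x.1) (Γ x)) {g : X → ℝ} (hg : Continuous g)
    (hg0 : ∀ x, 0 ≤ g x) {c a : ℝ} (hc : 0 < c)
    (ha : Tendsto (fun n : ℕ => (1 / (n : ℝ)) * ∑ i ∈ Finset.range n, g (H i)) atTop (𝓝 a)) :
    loeb k (Γ ⁻¹' {p | c < g p}) ≤ ENNReal.ofReal (a / c) := by
  let S := {i | c < g (H i)}
  obtain ⟨p, -, hp⟩ := exists_standardPart_counting (k := k) (M.const S)
  -- The condition `c < g` is open, so it passes from the standard part back to `*H(x)`.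
  have hsub : Γ ⁻¹' {p | c < g p} ⊆ internalSubset k (M.const S) := fun x hx =>
    mem_internal_const.2 (((hg.tendsto _).comp
      (isStandardPart_map_iff.1 (hΓ x))).eventually_const_lt hx)
  refine (measure_mono hsub).trans ((loeb_internalSubset_le hp).trans ?_)
  refine ENNReal.ofReal_le_ofReal ((le_div_iff₀' hc).2 ?_)
  exact le_of_tendsto_of_tendsto ((isStandardPart_counting_const_iff.1 hp).const_mul c)
    (ha.mono_left hk.type_le_atTop)
    (Eventually.of_forall fun n => proportion_preimage_mul_le hg0 n)

theorem map_standardPart_eq (hM : M.Saturated) (hk : M.Infinite k) [CompactSpace X]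
    [TopologicalSpace.PseudoMetrizableSpace X] [MeasurableSpace X] [BorelSpace X]
    (hΓ : ∀ x, M.IsStandardPart (M.map H x.1) (Γ x)) (hmeas : Measurable Γ)
    {ρ : Measure X} [IsProbabilityMeasure ρ]
    (h : ∀ g : C(X, ℝ), Tendsto (fun n : ℕ => (1 / (n : ℝ)) * ∑ i ∈ Finset.range n, g (H i))
      atTop (𝓝 (∫ x, g x ∂ρ))) : (loeb k).map Γ = ρ := by
  have : IsProbabilityMeasure (loeb k) := ⟨loeb_univ hM hk⟩
  have := Measure.isProbabilityMeasure_map (μ := loeb k) hmeas.aemeasurable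
  refine measure_eq_of_forall_isClosed_le_lintegral fun F g hF hg => ?_
  rw [Measure.map_apply hmeas hF.measurableSet]
  have hgc : Continuous fun x => (g x : ℝ) := NNReal.continuous_coe.comp g.continuous
  have hint : ∫⁻ x, g x ∂ρ = ENNReal.ofReal (∫ x, (g x : ℝ) ∂ρ) :=
    lintegral_coe_eq_integral _ (g.integrable_of_nnreal ρ)
  rw [hint]
  -- On `F` only `1 ≤ g` is known, so the open superlevel sets containing `F` have `c < 1`; the
  -- bound is recovered in the limit.
  have hlim : Tendsto (fun c : ℝ => ENNReal.ofReal ((∫ x, (g x : ℝ) ∂ρ) / c)) (𝓝[<] 1)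
      (𝓝 (ENNReal.ofReal ((∫ x, (g x : ℝ) ∂ρ) / 1))) :=
    (ENNReal.continuous_ofReal.tendsto _).comp
      ((tendsto_const_nhds.div tendsto_id one_ne_zero).mono_left nhdsWithin_le_nhds)
  rw [div_one] at hlim
  refine ge_of_tendsto hlim ?_
  filter_upwards [Ioo_mem_nhdsLT (zero_lt_one' ℝ)] with c hc
  refine (measure_mono fun x hx => ?_).trans
    (loeb_preimage_le hk hΓ hgc (fun x => (g x).2) hc.1 (h ⟨_, hgc⟩))
  exact hc.2.trans_le (by exact_mod_cast hg _ hx)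

end StandardPartMap

/-! ### The rotation -/

theorem loeb_last_eq_zero (hk : M.Infinite k) :
    loeb k {x | ¬ M.Rel₂ (· < ·) (M.map (· + 1) x.1) k} = 0 := by
  -- The exceptional set is contained in the internal singleton `{k - 1}`, of counting measure at
  -- most `1/k`. Truncated subtraction at `n = 0` is harmless, since nothing lies below `0`.
  have hp : M.IsStandardPart (counting k (M.map (fun n => {n - 1}) k)) 0 := by
    have := isStandardPart_counting_iff (κ := fun n => n) (S := fun n => {n - 1}) (z := k) (p := 0)
    rw [map_id] at this
    rw [this]
    refine Tendsto.mono_left ?_ hk.type_le_atTop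
    refine squeeze_zero (fun n => (proportion_mem _ _).1) (fun n => ?_)
      tendsto_one_div_atTop_nhds_zero_nat
    unfold proportion
    gcongr
    have h1 : ({n - 1} ∩ Set.Iio n : Set ℕ).ncard ≤ ({n - 1} : Set ℕ).ncard :=
      Set.ncard_le_ncard Set.inter_subset_left
    rw [Set.ncard_singleton] at h1
    exact_mod_cast h1
  refine le_antisymm ((measure_mono fun x hx => ?_).trans
    ((loeb_internalSubset_le hp).trans (by simp))) zero_le
  obtain ⟨x, hxk⟩ := x
  change ¬ M.Rel₂ (· < ·) (M.map (· + 1) x) k at hx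
  change x ∈ M.internal _
  obtain ⟨z, rfl, rfl⟩ := exists_pair x k
  rw [map_map, rel₂_map_map, ← Ultrafilter.eventually_not] at hx
  rw [rel₂_map_map] at hxk
  rw [map_map, map_mem_internal]
  filter_upwards [hx, hxk] with a h1 h2
  rw [Set.mem_singleton_iff]
  omega

/-- Away from the last point the rotation is `x + 1`, which shifts the orbit once; continuity lets
the shift commute with the standard part. -/
theorem standardPart_rotation {α : ℕ → I} (hk : M.Infinite k) {Γ : M.Seg k → (ℕ → I)}
    (hΓ : ∀ x : M.Seg k, M.IsStandardPart (M.map (fun n : ℕ => shift^[n] α) x.1) (Γ x))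
    {x : M.Seg k} (hx : M.Rel₂ (· < ·) (M.map (· + 1) x.1) k) :
    Γ (rotation hk x) = shift (Γ x) := by
  refine isStandardPart_unique (hΓ _) ?_
  have h : (rotation hk x).1 = M.map (· + 1) x.1 := congrArg Subtype.val (dif_pos hx)
  rw [h, map_map, isStandardPart_map_iff]
  simp only [Function.iterate_succ_apply']
  exact (continuous_shift.tendsto _).comp (isStandardPart_map_iff.1 (hΓ x))

end Model
end Nonstandard

/-! ### The factor map. -/

theorem mainTheorem3 (M : Nonstandard.Model) (hM : M.Saturated)
    (k : M.Ext ℕ) (hk : M.Infinite k)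
    (ρ : Measure (ℕ → I)) [IsProbabilityMeasure ρ] (hρ : MeasurePreserving Nonstandard.shift ρ ρ)
    (α : ℕ → I) (hα : Nonstandard.IsTypical ρ α) :
    ∃ Γ : M.LoebSpace k → (ℕ → I),
      (∀ x : M.Seg k, M.IsStandardPart (M.map (fun n : ℕ => Nonstandard.shift^[n] α) x.1) (Γ x)) ∧
      Nonstandard.IsFactorMap (Nonstandard.Model.loeb k).completion
        (Nonstandard.Model.rotation hk) ρ Nonstandard.shift Γ := by
  choose Γ hΓ using fun x : M.Seg k =>
    Nonstandard.Model.exists_isStandardPart_map (fun n : ℕ => Nonstandard.shift^[n] α) x.1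
  have hmeas : Measurable Γ := measurable_pi_iff.2 fun i =>
    Measurable.subtype_mk (Nonstandard.Model.measurable_comp_standardPart hΓ
      (g := fun p => (p i : ℝ)) (by fun_prop))
  have hnull : Measurable (α := M.LoebSpace k) Γ := hmeas.nullMeasurable.measurable'
  refine ⟨Γ, hΓ, ⟨hnull, ?_⟩, ?_⟩
  · refine Measure.ext fun E hE => ?_
    rw [Measure.map_apply hnull hE]
    -- The completion takes the same values as the Loeb measure, so the image can be computed before
    -- completing.
    refine (Measure.map_apply (μ := Nonstandard.Model.loeb k) hmeas hE).symm.trans ?_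
    rw [Nonstandard.Model.map_standardPart_eq hM hk hΓ hmeas hα]
  · refine measure_mono_null (μ := Nonstandard.Model.loeb k) (fun x hx => ?_)
      (Nonstandard.Model.loeb_last_eq_zero hk)
    exact fun h => hx (Nonstandard.Model.standardPart_rotation hk hΓ h)
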